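/- **Lemma (uniform convergence via pseudo-dimension).** Let $\mathcal X\subseteq\mathbb R^n$ carry its Borel $\sigma$-algebra, let $\mathcal A$ be a finite nonempty set of actions, let $T_x(\cdot\mid x,a)$ be a measurable stochastic kernel from $\mathcal X\times\mathcal A$ to $\mathcal X$, and let $A,K\in\mathcal B(\mathcal X)$ be a safe set and a target set. For measurable $V:\mathcal X\to[0,1]$ put $$(\mathsf T V)(x)=\max_{a\in\mathcal A}\int_{\mathcal X}\big(\mathbf 1_K(y)+\mathbf 1_{A\setminus K}(y)V(y)\big)\,T_x(dy\mid x,a).$$ Let $\mathcal W$ be a finitely parameterized class of measurable functions $\mathcal X\to[0,1]$, meaning that $\mathcal W=\{f(\theta,\cdot):\theta\in\Theta\}$ for some $m$, some Borel set $\Theta\subseteq\mathbb R^m$ and some jointly measurable $f:\mathbb R^m\times\mathcal X\to\mathbb R$. A finite set $S\subseteq\mathcal X$ is *shattered* by $\mathcal W$ if there are $r_x\in[0,1]$ ($x\in S$) such that for every $T\subseteq S$ there is $w\in\mathcal W$ with $w(x)\ge r_x$ for $x\in T$ and $w(x)<r_x$ for $x\in S\setminus T$; the *pseudo-dimension* $\dim_p(\mathcal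 W)$ is the largest cardinality of a shattered set. Assume $\dim_p(\mathcal W)=d<\infty$. Let $W:\mathcal X\to[0,1]$ be any fixed measurable function (for example an element of $\mathcal W$), let $\eta$ be any probability distribution on $\mathcal X$ (for example one supported on $A\setminus K$), let $N\ge1$, let $x^1,\dots,x^N$ be independent random variables with distribution $\eta$, and let $p\ge1$ be real. For a measurable bounded function $h$ on $\mathcal X$ write $$\|h\|_{p,\eta}=\Big(\int_{\mathcal X}|h|^p\,d\eta\Big)^{1/p},\qquad \|h\|_{p,\hat\eta}=\Big(\frac1N\sum_{i=1}^N|h(x^i)|^p\Big)^{1/p}.$$ Then for every $\epsilon_2>0$ $$\mathbf P\Big\{\sup_{w\in\mathcal W}\Big|\,\|w-\mathsf T W\|_{p,\eta}^p-\|w-\mathsf T W\|_{p,\hat\eta}^p\Big|\ \ge\ \epsilon_2^p\Big\}\ \le\ 4e(d+1)\Big(\frac{32e}{\epsilon_2^p}\Big)^{d}e^{-N\epsilon_2^{2p}/128}.$$ -/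

import Mathlib

open MeasureTheory ProbabilityTheory Set

namespace ReachAvoid

/-- A finite set `S` is shattered by the class `F` of functions if there are thresholds
`r x ∈ [0,1]`, `x ∈ S`, such that for every `T ⊆ S` some `f ∈ F` satisfies `f ≥ r` on `T` and
`f < r` on `S \ T`. -/
def Shatters {X : Type*} (F : Set (X → ℝ)) (S : Finset X) : Prop :=
  ∃ r : X → ℝ, (∀ x ∈ S, r x ∈ Icc (0 : ℝ) 1) ∧
    ∀ T ⊆ S, ∃ f ∈ F, (∀ x ∈ T, r x ≤ f x) ∧ (∀ x ∈ S, x ∉ T → f x < r x)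

/-- The pseudo-dimension: the largest cardinality of a shattered set (`⊤` if these cardinalities
are unbounded). -/
noncomputable def pseudoDim {X : Type*} (F : Set (X → ℝ)) : ℕ∞ :=
  ⨆ (S : Finset X) (_ : Shatters F S), (S.card : ℕ∞)

/-- `F` is finitely parameterized: `F = {f θ | θ ∈ Θ}` for a Borel set `Θ ⊆ ℝ^m` of parameters
and a map `(θ, x) ↦ f θ x` that is jointly measurable. -/
def FinitelyParameterized {X : Type*} [MeasurableSpace X] (F : Set (X → ℝ)) : Prop :=
  ∃ (m : ℕ) (Θ : Set (EuclideanSpace ℝ (Fin m))) (f : EuclideanSpace ℝ (Fin m) → X → ℝ),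
    MeasurableSet Θ ∧ Measurable (Function.uncurry f) ∧ F = f '' Θ

/-- The dynamic programming operator of the reach-avoid problem with safe set `A` and target set
`K`: `(𝖳 V)(x) = max_a E[1_K(y) + 1_{A \ K}(y) V(y)]` with `y ∼ Tx(· | x, a)`. -/
noncomputable def dpOperator {X 𝒜 : Type*} [MeasurableSpace X] [MeasurableSpace 𝒜] [Fintype 𝒜]
    [Nonempty 𝒜] (Tx : Kernel (X × 𝒜) X) (A K : Set X) (V : X → ℝ) (x : X) : ℝ :=
  Finset.univ.sup' Finset.univ_nonempty fun a : 𝒜 =>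
    ∫ y, (K.indicator (fun _ => (1 : ℝ)) y + (A \ K).indicator V y) ∂(Tx (x, a))

/-- The weighted norm `‖h‖_{p,η} = (∫ |h|^p dη)^{1/p}`. -/
noncomputable def weightedNorm {X : Type*} [MeasurableSpace X] (p : ℝ) (η : Measure X)
    (h : X → ℝ) : ℝ :=
  (∫ x, |h x| ^ p ∂η) ^ (1 / p)

/-- The empirical norm `‖h‖_{p,η̂} = (N⁻¹ ∑ i, |h (x i)|^p)^{1/p}` over base points
`x 1, …, x N`. -/
noncomputable def empiricalNorm {X : Type*} {N : ℕ} (p : ℝ) (x : Fin N → X) (h : X → ℝ) : ℝ :=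
  ((1 / (N : ℝ)) * ∑ i, |h (x i)| ^ p) ^ (1 / p)

end ReachAvoid

/-!
The norms enter only through their `p`-th powers, so the quantity to bound is the deviation of the
empirical mean of `g w = |w - U| ^ p`, `U = 𝖳 V`, from its expectation, uniformly over `w ∈ 𝒲`. Write
`b = ε₂ ^ p`. One may assume that `b ≤ 1` and that the asserted bound is at most `1`.

The proof is symmetrization followed by counting, as for Vapnik–Chervonenkis classes. By Chebyshev's
inequality a large deviation forces, with conditional probability at least `1 / 2`, a large
difference between the empirical means over the sample and over an independent second one
(`measure_le_two_mul_prod`). The law of the double sample is invariant under exchanging the two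
points of any pair, so it suffices to count, for a fixed double sample, the exchanges that produce
a large difference (`measure_le_of_card_swapPairs_le`). For one `w` this is Hoeffding's inequality
for random signs. On a fixed double sample finitely many `w` are enough: if `w` and `v` satisfy the
same inequalities `U y ± (j / L) ^ (1 / p) ≤ w y` then `g w` and `g v` differ by at most `1 / L`, and
the Sauer–Shelah lemma bounds the number of such patterns, because indices shattered by them give
points shattered by `𝒲` (`card_le_of_shatters_pattern`). The grid is equidistant for the `p`-th
power, which is why `p` does not enter the bound although `|·| ^ p` has Lipschitz constant `p`.

This gives the bound `4 * M * exp (-N * b ^ 2 / 8)`, where `M`, the number of patterns, grows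
polynomially in `N / b`. Its rate is sixteen times the required one, and as the required bound is at
most `1`, the surplus absorbs `M` (`sum_choose_mul_exp_le`); no sharp covering numbers are needed.

Averaging over exchanges requires the event "some `w ∈ 𝒲` has a large difference" to be null
measurable, although the class is uncountable. It is the projection of a measurable set along the
Borel set of parameters, hence null measurable (`MeasurableSet.nullMeasurableSet_image_snd`) by
Choquet's capacitability argument for analytic sets.
-/

/-! ### Projections of measurable sets are null measurable -/

theorem isCompact_setOf_forall_le (k : ℕ → ℕ) : IsCompact {x : ℕ → ℕ | ∀ i, x i ≤ k i} := by
  have : {x : ℕ → ℕ | ∀ i, x i ≤ k i} = Set.pi univ fun i => Iic (k i) := by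
    ext x; simp only [mem_ofPred_eq, mem_univ_pi, mem_Iic]
  rw [this]
  exact isCompact_univ_pi fun i => (finite_Iic (k i)).isCompact

/-- The generalized tube lemma for the Baire space: a neighbourhood of the compact box
`{x | ∀ i, x i ≤ k i}` contains a box that constrains only finitely many coordinates. -/
theorem exists_finite_box_subset {k : ℕ → ℕ} {O : Set (ℕ → ℕ)} (hO : IsOpen O)
    (hk : {x : ℕ → ℕ | ∀ i, x i ≤ k i} ⊆ O) :
    ∃ n, {x : ℕ → ℕ | ∀ i < n, x i ≤ k i} ⊆ O := by
  have hcyl : ∀ x ∈ O, ∃ n, PiNat.cylinder x n ⊆ O := by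
    intro x hx
    obtain ⟨_, ⟨z, n, rfl⟩, hxz, hzO⟩ :=
      (PiNat.isTopologicalBasis_cylinders (fun _ => ℕ)).exists_subset_of_mem_open hx hO
    exact ⟨n, by rwa [PiNat.mem_cylinder_iff_eq.1 hxz]⟩
  choose! m hm using hcyl
  obtain ⟨t, ht, hcov⟩ := (isCompact_setOf_forall_le k).elim_nhds_subcover
    (fun x => PiNat.cylinder x (m x))
    fun x _ => (PiNat.isOpen_cylinder (fun _ => ℕ) x (m x)).mem_nhds (PiNat.self_mem_cylinder x _)
  refine ⟨t.sup m, fun z hz => ?_⟩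
  -- The truncation of `z` lies in the compact box and agrees with `z` on the relevant coordinates.
  have hy : (fun i => min (z i) (k i)) ∈ {x : ℕ → ℕ | ∀ i, x i ≤ k i} := fun i => min_le_right _ _
  obtain ⟨x, hxt, hx⟩ := mem_iUnion₂.1 (hcov hy)
  refine hm x (hk (ht x hxt)) fun i hi => ?_
  rw [← hx i hi]
  exact (min_eq_left (hz i (hi.trans_le (Finset.le_sup (f := m) hxt)))).symm

/-- Choquet's capacitability argument for a finite measure: an analytic set is exhausted up to `ε`
by a compact subset, the image of a compact box of the Baire space. -/
theorem MeasureTheory.AnalyticSet.exists_isCompact_subset_measure_le {α : Type*}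
    [TopologicalSpace α] [TopologicalSpace.PseudoMetrizableSpace α] [MeasurableSpace α]
    [BorelSpace α] (μ : Measure α) [IsFiniteMeasure μ] {s : Set α} (hs : AnalyticSet s)
    {ε : ENNReal} (hε : ε ≠ 0) :
    ∃ K ⊆ s, IsCompact K ∧ μ s ≤ μ K + ε := by
  rw [AnalyticSet] at hs
  rcases hs with rfl | ⟨f, hf, rfl⟩
  · exact ⟨∅, subset_rfl, isCompact_empty, by simp⟩
  obtain ⟨δ, hδ, hδε⟩ := ENNReal.exists_pos_sum_of_countable' hε ℕ
  -- Bounding one more coordinate of the Baire space costs arbitrarily little outer measure, since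
  -- measures are continuous from below on all sets.
  have step : ∀ (C : Set (ℕ → ℕ)) (n : ℕ),
      ∃ k, μ (f '' C) ≤ μ (f '' (C ∩ {x | x n ≤ k})) + δ n := by
    intro C n
    have hU : f '' C = ⋃ k, f '' (C ∩ {x | x n ≤ k}) := by
      rw [← image_iUnion, ← inter_iUnion, iUnion_eq_univ_iff.2 fun x => ⟨x n, le_refl (x n)⟩,
        inter_univ]
    have hmono : Monotone fun k => f '' (C ∩ {x | x n ≤ k}) := fun a b hab =>
      image_mono (inter_subset_inter_right _ fun x hx => le_trans hx hab)
    have hm := hmono.measure_iUnion (μ := μ)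
    rw [← hU] at hm
    by_cases h0 : μ (f '' C) = 0
    · exact ⟨0, by simp [h0]⟩
    have hlt : μ (f '' C) - δ n < ⨆ k, μ (f '' (C ∩ {x | x n ≤ k})) := by
      rw [← hm]
      exact ENNReal.sub_lt_self (measure_ne_top _ _) h0 (hδ n).ne'
    obtain ⟨k, hk⟩ := lt_iSup_iff.1 hlt
    exact ⟨k, tsub_le_iff_right.1 hk.le⟩
  choose κ hκ using step
  let C : ℕ → Set (ℕ → ℕ) := fun n => n.rec univ fun n Cn => Cn ∩ {x | x n ≤ κ Cn n}
  let k : ℕ → ℕ := fun n => κ (C n) n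
  have hCs : ∀ n, C (n + 1) = C n ∩ {x | x n ≤ k n} := fun n => rfl
  have hC : ∀ n, C n = {x | ∀ i < n, x i ≤ k i} := by
    intro n
    induction n with
    | zero => ext x; simp [C]
    | succ n ih =>
      rw [hCs, ih]
      ext x
      simp only [mem_inter_iff, mem_ofPred_eq, Nat.lt_succ_iff_lt_or_eq, or_imp, forall_and,
        forall_eq]
  have hμC : ∀ n, μ (range f) ≤ μ (f '' C n) + ∑ i ∈ Finset.range n, δ i := by
    intro n
    induction n with
    | zero => simp [C]
    | succ n ih =>
      refine ih.trans ?_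
      rw [Finset.sum_range_succ, add_comm _ (δ n), ← add_assoc, hCs]
      gcongr
      exact hκ (C n) n
  refine ⟨f '' {x | ∀ i, x i ≤ k i}, image_subset_range _ _,
    (isCompact_setOf_forall_le k).image hf, ?_⟩
  rw [← tsub_le_iff_right]
  -- Outer regularity: it suffices to bound the measure of every open superset of the compact image.
  refine le_of_forall_gt fun r hr => ?_
  obtain ⟨U, hKU, hU, hμU⟩ := Set.exists_isOpen_lt_of_lt _ r hr
  obtain ⟨n, hn⟩ := exists_finite_box_subset (hU.preimage hf) (image_subset_iff.1 hKU)
  refine lt_of_le_of_lt ?_ hμU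
  rw [tsub_le_iff_right]
  refine (hμC n).trans (add_le_add (measure_mono ?_) ?_)
  · rw [hC, image_subset_iff]; exact hn
  · exact (ENNReal.sum_le_tsum _).trans hδε.le

theorem MeasureTheory.AnalyticSet.nullMeasurableSet {α : Type*} [TopologicalSpace α]
    [TopologicalSpace.MetrizableSpace α] [MeasurableSpace α] [BorelSpace α] (μ : Measure α)
    [IsFiniteMeasure μ] {s : Set α} (hs : AnalyticSet s) : NullMeasurableSet s μ := by
  have h : ∀ n : ℕ, ∃ K ⊆ s, IsCompact K ∧ μ s ≤ μ K + (n : ENNReal)⁻¹ := fun n =>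
    hs.exists_isCompact_subset_measure_le μ (by simp)
  choose K hKs hK hμ using h
  have hm : MeasurableSet (⋃ n, K n) := MeasurableSet.iUnion fun n => (hK n).measurableSet
  have hle : μ s ≤ μ (⋃ n, K n) := by
    have hlim : Filter.Tendsto (fun n : ℕ => μ (⋃ n, K n) + (n : ENNReal)⁻¹) Filter.atTop
        (nhds (μ (⋃ n, K n) + 0)) :=
      tendsto_const_nhds.add ENNReal.tendsto_inv_nat_nhds_zero
    rw [add_zero] at hlim
    refine ge_of_tendsto' hlim fun n => (hμ n).trans ?_
    gcongr
    exact subset_iUnion K n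
  exact hm.nullMeasurableSet.congr (ae_eq_of_subset_of_measure_ge (iUnion_subset hKs) hle
    hm.nullMeasurableSet (measure_ne_top _ _))

/-- The measurable projection theorem, for the projection along a Polish space. The space projected
onto need not be standard Borel: it is pulled back from the Cantor space. -/
theorem MeasurableSet.nullMeasurableSet_image_snd {Z Y : Type*} [TopologicalSpace Z]
    [PolishSpace Z] [MeasurableSpace Z] [BorelSpace Z] [MeasurableSpace Y]
    [MeasurableSpace.CountablyGenerated Y] [MeasurableSpace.SeparatesPoints Y] (μ : Measure Y)
    [IsFiniteMeasure μ] {B : Set (Z × Y)} (hB : MeasurableSet B) :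
    NullMeasurableSet (Prod.snd '' B) μ := by
  obtain ⟨S, ⟨e⟩⟩ := MeasurableSpace.measurableEquiv_nat_bool_of_countablyGenerated Y
  have hφ : Measurable fun y => (e y : ℕ → Bool) := measurable_subtype_coe.comp e.measurable
  have hcomap : MeasurableSpace.comap (fun y => (e y : ℕ → Bool)) MeasurableSpace.pi = ‹_› :=
    MeasurableSpace.comap_comp.symm.trans e.measurableEmbedding.comap_eq
  have hprod : (Prod.instMeasurableSpace : MeasurableSpace (Z × Y)) = MeasurableSpace.comap
      (Prod.map (id : Z → Z) fun y => (e y : ℕ → Bool)) Prod.instMeasurableSpace := by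
    refine Eq.trans ?_ (MeasurableSpace.comap_prodMap _ _).symm
    rw [hcomap, MeasurableSpace.comap_id]
    rfl
  rw [hprod] at hB
  obtain ⟨B', hB', rfl⟩ := hB
  have hpre : Prod.snd '' (Prod.map (id : Z → Z) (fun y => (e y : ℕ → Bool)) ⁻¹' B')
      = (fun y => (e y : ℕ → Bool)) ⁻¹' (Prod.snd '' B') := by
    ext y
    constructor
    · rintro ⟨⟨z, y⟩, h, rfl⟩
      exact ⟨_, h, rfl⟩
    · rintro ⟨⟨z, c⟩, h, rfl⟩
      exact ⟨(z, y), h, rfl⟩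
  rw [hpre]
  have : TopologicalSpace.IsCompletelyMetrizableSpace (ℕ → Bool) :=
    TopologicalSpace.IsCompletelyMetrizableSpace.pi_countable
  have hA : AnalyticSet (Prod.snd '' B') := hB'.analyticSet.image_of_continuous continuous_snd
  exact (hA.nullMeasurableSet (μ.map fun y => (e y : ℕ → Bool))).preimage
    (hφ.measurePreserving μ).quasiMeasurePreserving

/-! ### Counting threshold patterns -/

namespace ReachAvoid

theorem Shatters.card_le {X : Type*} {F : Set (X → ℝ)} {S : Finset X} (h : Shatters F S) {d : ℕ}
    (hd : pseudoDim F = d) : S.card ≤ d := by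
  have : (S.card : ℕ∞) ≤ pseudoDim F :=
    le_iSup₂ (f := fun (S : Finset X) (_ : Shatters F S) => (S.card : ℕ∞)) S h
  rw [hd] at this
  exact_mod_cast this

open Classical in
/-- The threshold pattern of `w` at the points `y i` with thresholds `c i`: the set of indices `i`
with `c i ≤ w (y i)`. -/
noncomputable def pattern {X ι : Type*} [Fintype ι] (y : ι → X) (c : ι → ℝ) (w : X → ℝ) :
    Finset ι :=
  Finset.univ.filter fun i => c i ≤ w (y i)

theorem mem_pattern {X ι : Type*} [Fintype ι] {y : ι → X} {c : ι → ℝ} {w : X → ℝ} {i : ι} :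
    i ∈ pattern y c w ↔ c i ≤ w (y i) := by
  simp [pattern]

open Classical in
/-- Indices that are shattered by threshold patterns belong to distinct points, since two
thresholds at one point give nested conditions; so these points form a shattered set. -/
theorem card_le_of_shatters_pattern {X ι : Type*} [Fintype ι] {F : Set (X → ℝ)}
    (hF : ∀ w ∈ F, ∀ x, w x ∈ Icc (0 : ℝ) 1) {d : ℕ} (hd : pseudoDim F = d) (y : ι → X)
    (c : ι → ℝ) {𝒜 : Finset (Finset ι)} (h𝒜 : ∀ u ∈ 𝒜, ∃ w ∈ F, pattern y c w = u)
    {s : Finset ι} (hs : 𝒜.Shatters s) : s.card ≤ d := by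
  have hsep : ∀ t ⊆ s, ∃ w ∈ F, ∀ i ∈ s, c i ≤ w (y i) ↔ i ∈ t := by
    intro t ht
    obtain ⟨u, hu, hsu⟩ := hs ht
    obtain ⟨w, hw, rfl⟩ := h𝒜 u hu
    refine ⟨w, hw, fun i hi => ?_⟩
    rw [← hsu, Finset.mem_inter, mem_pattern]
    exact ⟨fun h => ⟨hi, h⟩, fun h => h.2⟩
  have hle : ∀ i ∈ s, ∀ j ∈ s, y i = y j → c i ≤ c j → i = j := by
    intro i hi j hj hij hc
    obtain ⟨w, -, hw⟩ := hsep {j} (by simpa using hj)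
    have hj' := (hw j hj).2 (by simp)
    have := (hw i hi).1 (by rw [hij]; exact hc.trans hj')
    simpa using this
  have hinj : Set.InjOn y s := by
    intro i hi j hj hij
    rcases le_total (c i) (c j) with h | h
    · exact hle i hi j hj hij h
    · exact (hle j hj i hi hij.symm h).symm
  -- As `y` is injective on `s`, the thresholds descend to the points.
  obtain ⟨r, hr⟩ : ∃ r : X → ℝ, ∀ i ∈ s, r (y i) = c i := by
    refine ⟨fun x => if h : ∃ i ∈ s, y i = x then c h.choose else 0, fun i hi => ?_⟩
    have h : ∃ j ∈ s, y j = y i := ⟨i, hi, rfl⟩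
    simp only [dif_pos h]
    rw [hinj h.choose_spec.1 hi h.choose_spec.2]
  rw [← Finset.card_image_of_injOn hinj]
  refine Shatters.card_le ⟨r, ?_, ?_⟩ hd
  · intro x hx
    obtain ⟨i, hi, rfl⟩ := Finset.mem_image.1 hx
    rw [hr i hi]
    obtain ⟨w, hwF, hw⟩ := hsep s subset_rfl
    obtain ⟨v, hvF, hv⟩ := hsep ∅ (Finset.empty_subset _)
    refine ⟨?_, ((hw i hi).2 hi).trans (hF w hwF _).2⟩
    have : ¬ c i ≤ v (y i) := fun h => by simpa using (hv i hi).1 h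
    exact (hF v hvF (y i)).1.trans (not_le.1 this).le
  · intro T _
    obtain ⟨w, hwF, hw⟩ := hsep (s.filter fun i => y i ∈ T) (Finset.filter_subset _ _)
    refine ⟨w, hwF, fun x hx => ?_, fun x hx hxT => ?_⟩
    · obtain ⟨i, hi, rfl⟩ := Finset.mem_image.1 (‹T ⊆ _› hx)
      rw [hr i hi]
      exact (hw i hi).2 (by simp [hi, hx])
    · obtain ⟨i, hi, rfl⟩ := Finset.mem_image.1 hx
      rw [hr i hi]
      refine not_le.1 fun h => hxT ?_
      simpa [hi] using (hw i hi).1 h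

open Classical in
/-- The Sauer–Shelah lemma for a class of finite pseudo-dimension: finitely many members of the
class, polynomially many in the number of thresholds, realize all threshold patterns. -/
theorem exists_finset_pattern_eq {X ι : Type*} [Fintype ι] {F : Set (X → ℝ)}
    (hF : ∀ w ∈ F, ∀ x, w x ∈ Icc (0 : ℝ) 1) {d : ℕ} (hd : pseudoDim F = d) (y : ι → X)
    (c : ι → ℝ) :
    ∃ R : Finset (X → ℝ), R.card ≤ ∑ k ∈ Finset.Iic d, (Fintype.card ι).choose k ∧
      (∀ v ∈ R, v ∈ F) ∧ ∀ w ∈ F, ∃ v ∈ R, pattern y c v = pattern y c w := by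
  let 𝒜 : Finset (Finset ι) := Finset.univ.filter fun u => ∃ w ∈ F, pattern y c w = u
  have h𝒜 : ∀ u ∈ 𝒜, ∃ w ∈ F, pattern y c w = u := fun u hu => (Finset.mem_filter.1 hu).2
  choose! v hvF hv using h𝒜
  refine ⟨𝒜.image v, ?_, ?_, fun w hw => ?_⟩
  · have hdim : 𝒜.vcDim ≤ d := Finset.sup_le fun s hs =>
      card_le_of_shatters_pattern hF hd y c (fun u hu => ⟨v u, hvF u hu, hv u hu⟩)
        (Finset.mem_shatterer.1 hs)
    refine Finset.card_image_le.trans (𝒜.card_le_card_shatterer.trans ?_)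
    refine Finset.card_shatterer_le_sum_vcDim.trans ?_
    exact Finset.sum_le_sum_of_subset (Finset.Iic_subset_Iic.2 hdim)
  · intro u hu
    obtain ⟨t, ht, rfl⟩ := Finset.mem_image.1 hu
    exact hvF t ht
  · have hw𝒜 : pattern y c w ∈ 𝒜 := Finset.mem_filter.2 ⟨Finset.mem_univ _, w, hw, rfl⟩
    exact ⟨_, Finset.mem_image_of_mem v hw𝒜, hv _ hw𝒜⟩

end ReachAvoid

/-- With `l` a free parameter this trades the polynomial growth in `n` for an exponential of
arbitrarily small rate. -/
theorem sum_choose_mul_pow_le_exp (n d : ℕ) {l : ℝ} (hl : 0 < l) (hl1 : l ≤ 1) :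
    ((∑ k ∈ Finset.Iic d, n.choose k : ℕ) : ℝ) * l ^ d ≤ Real.exp (l * n) := by
  calc ((∑ k ∈ Finset.Iic d, n.choose k : ℕ) : ℝ) * l ^ d
      = ∑ k ∈ Finset.Iic d, (n.choose k : ℝ) * l ^ d := by
        push_cast; rw [Finset.sum_mul]
    _ ≤ ∑ k ∈ Finset.Iic d, (n.choose k : ℝ) * l ^ k := by
        refine Finset.sum_le_sum fun k hk => ?_
        exact mul_le_mul_of_nonneg_left
          (pow_le_pow_of_le_one hl.le hl1 (Finset.mem_Iic.1 hk)) (Nat.cast_nonneg _)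
    _ ≤ ∑ k ∈ Finset.range (n + 1), (n.choose k : ℝ) * l ^ k := by
        rw [← Finset.sum_filter_of_ne (p := fun k => k < n + 1) fun k _ hk => ?_]
        · exact Finset.sum_le_sum_of_subset_of_nonneg
            (fun k hk => Finset.mem_range.2 (Finset.mem_filter.1 hk).2)
            fun k _ _ => by positivity
        · by_contra hkn
          exact hk (by rw [Nat.choose_eq_zero_of_lt (by simpa using hkn)]; simp)
    _ = (l + 1) ^ n := by
        rw [add_pow]
        exact Finset.sum_congr rfl fun k _ => by simp [mul_comm]
    _ ≤ Real.exp l ^ n := by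
        gcongr
        exact Real.add_one_le_exp l
    _ = Real.exp (l * n) := by rw [← Real.exp_nat_mul, mul_comm]

/-! ### A discretization of the `p`-th power -/

/-- One half of the resolution estimate: if `m / L ≤ |t| ^ p < (m + 1) / L`, then `t` lies strictly
between the thresholds `±((m + 1) / L) ^ (1 / p)`, hence so does `s`, up to the lower end. -/
theorem abs_rpow_le_add_inv_of_forall_threshold {L : ℕ} (hL : 0 < L) {p : ℝ} (hp : 0 < p)
    {s t : ℝ} (hs : |s| ≤ 1)
    (h1 : ∀ j ≤ L, ((j : ℝ) / L) ^ (1 / p) ≤ s → ((j : ℝ) / L) ^ (1 / p) ≤ t)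
    (h2 : ∀ j ≤ L, -((j : ℝ) / L) ^ (1 / p) ≤ t → -((j : ℝ) / L) ^ (1 / p) ≤ s) :
    |s| ^ p ≤ |t| ^ p + 1 / L := by
  have hL' : (0 : ℝ) < L := Nat.cast_pos.2 hL
  have ht0 : 0 ≤ |t| ^ p := Real.rpow_nonneg (abs_nonneg t) p
  have hlo : (⌊L * |t| ^ p⌋₊ : ℝ) ≤ L * |t| ^ p := Nat.floor_le (by positivity)
  have hhi : L * |t| ^ p < (⌊L * |t| ^ p⌋₊ : ℝ) + 1 := Nat.lt_floor_add_one _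
  set m := ⌊L * |t| ^ p⌋₊
  have key : ((m : ℝ) + 1) / L ≤ |t| ^ p + 1 / L := by
    rw [add_div]
    gcongr
    rwa [div_le_iff₀' hL']
  by_cases hm : m + 1 ≤ L
  · refine le_trans ?_ key
    have hq : 0 ≤ ((m : ℝ) + 1) / L := by positivity
    have hpow : ((((m : ℝ) + 1) / L) ^ (1 / p)) ^ p = ((m : ℝ) + 1) / L := by
      rw [← Real.rpow_mul hq, one_div_mul_cancel hp.ne', Real.rpow_one]
    have ht : |t| < (((m : ℝ) + 1) / L) ^ (1 / p) := by
      rw [← Real.rpow_lt_rpow_iff (abs_nonneg t) (Real.rpow_nonneg hq _) hp, hpow,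
        lt_div_iff₀ hL']
      linarith
    have h1' := h1 (m + 1) hm
    have h2' := h2 (m + 1) hm
    push_cast at h1' h2'
    have hsle : |s| ≤ (((m : ℝ) + 1) / L) ^ (1 / p) := by
      rw [abs_le]
      refine ⟨h2' (abs_lt.1 ht).1.le, ?_⟩
      by_contra hcon
      exact absurd (h1' (not_le.1 hcon).le) (not_le.2 (abs_lt.1 ht).2)
    calc |s| ^ p ≤ ((((m : ℝ) + 1) / L) ^ (1 / p)) ^ p :=
          Real.rpow_le_rpow (abs_nonneg s) hsle hp.le
      _ = _ := hpow
  · have hm' : (L : ℝ) ≤ m + 1 := by exact_mod_cast (not_le.1 hm).le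
    calc |s| ^ p ≤ 1 := Real.rpow_le_one (abs_nonneg s) hs hp.le
      _ ≤ ((m : ℝ) + 1) / L := by rwa [le_div_iff₀ hL', one_mul]
      _ ≤ _ := key

/-- The grid `±(j / L) ^ (1 / p)`, equidistant for the `p`-th power, resolves `|·| ^ p` on `[-1, 1]`
up to `1 / L`. Its size does not depend on `p`. -/
theorem abs_sub_abs_rpow_le_inv_of_forall_threshold {L : ℕ} (hL : 0 < L) {p : ℝ} (hp : 0 < p)
    {s t : ℝ} (hs : |s| ≤ 1) (ht : |t| ≤ 1)
    (h1 : ∀ j ≤ L, ((j : ℝ) / L) ^ (1 / p) ≤ s ↔ ((j : ℝ) / L) ^ (1 / p) ≤ t)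
    (h2 : ∀ j ≤ L, -((j : ℝ) / L) ^ (1 / p) ≤ s ↔ -((j : ℝ) / L) ^ (1 / p) ≤ t) :
    |(|s| ^ p - |t| ^ p)| ≤ 1 / L := by
  have hst := abs_rpow_le_add_inv_of_forall_threshold hL hp hs (fun j hj => (h1 j hj).1)
    fun j hj => (h2 j hj).2
  have hts := abs_rpow_le_add_inv_of_forall_threshold hL hp ht (fun j hj => (h1 j hj).2)
    fun j hj => (h2 j hj).1
  rw [abs_le]
  constructor <;> linarith

/-! ### Random signs -/

theorem sum_exp_signed_sum {N : ℕ} (a : Fin N → ℝ) :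
    ∑ σ : Fin N → Bool, Real.exp (∑ i, if σ i then a i else -a i)
      = ∏ i, (2 * Real.cosh (a i)) := by
  have h : ∀ i, 2 * Real.cosh (a i) = ∑ s : Bool, Real.exp (if s then a i else -a i) := by
    intro i
    rw [Real.cosh_eq]
    simp
    ring
  simp_rw [h, Finset.prod_univ_sum, Fintype.piFinset_univ, Real.exp_sum]

open Classical in
theorem card_le_signed_sum_le {N : ℕ} {a : Fin N → ℝ} (ha : ∀ i, |a i| ≤ 1) {t : ℝ}
    (ht : 0 ≤ t) :
    ((Finset.univ.filter fun σ : Fin N → Bool => N * t ≤ ∑ i, if σ i then a i else -a i).card : ℝ)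
      ≤ 2 ^ N * Real.exp (-(N * t ^ 2 / 2)) := by
  set S := Finset.univ.filter fun σ : Fin N → Bool => N * t ≤ ∑ i, if σ i then a i else -a i
  -- Markov's inequality for the exponential moment with the optimal parameter `t`.
  have h1 : (S.card : ℝ) * Real.exp (N * t ^ 2) ≤ 2 ^ N * Real.exp (N * t ^ 2 / 2) := by
    calc (S.card : ℝ) * Real.exp (N * t ^ 2) = ∑ σ ∈ S, Real.exp (N * t ^ 2) := by simp
      _ ≤ ∑ σ ∈ S, Real.exp (∑ i, if σ i then t * a i else -(t * a i)) := by
        refine Finset.sum_le_sum fun σ hσ => Real.exp_le_exp.2 ?_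
        have := mul_le_mul_of_nonneg_left (Finset.mem_filter.1 hσ).2 ht
        rw [Finset.mul_sum] at this
        calc N * t ^ 2 = t * (N * t) := by ring
          _ ≤ _ := this
          _ = _ := Finset.sum_congr rfl fun i _ => by split_ifs <;> ring
      _ ≤ ∑ σ : Fin N → Bool, Real.exp (∑ i, if σ i then t * a i else -(t * a i)) :=
        Finset.sum_le_sum_of_subset_of_nonneg (Finset.subset_univ _)
          fun _ _ _ => (Real.exp_pos _).le
      _ = ∏ i, (2 * Real.cosh (t * a i)) := sum_exp_signed_sum _
      _ ≤ ∏ _i : Fin N, (2 * Real.exp (t ^ 2 / 2)) := by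
        refine Finset.prod_le_prod (fun i _ => by positivity) fun i _ => ?_
        have hsq : (t * a i) ^ 2 ≤ t ^ 2 := by
          rw [mul_pow]
          exact mul_le_of_le_one_right (sq_nonneg t) ((sq_le_one_iff_abs_le_one _).2 (ha i))
        have := (Real.cosh_le_exp_half_sq (t * a i)).trans (Real.exp_le_exp.2
          (div_le_div_of_nonneg_right hsq zero_le_two))
        linarith
      _ = 2 ^ N * Real.exp (N * t ^ 2 / 2) := by
        rw [Finset.prod_const, Finset.card_univ, Fintype.card_fin, mul_pow, ← Real.exp_nat_mul]
        ring_nf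
  have h2 : Real.exp (N * t ^ 2 / 2) = Real.exp (-(N * t ^ 2 / 2)) * Real.exp (N * t ^ 2) := by
    rw [← Real.exp_add]; ring_nf
  rw [h2, ← mul_assoc] at h1
  exact le_of_mul_le_mul_right h1 (Real.exp_pos _)

open Classical in
/-- Hoeffding's inequality for Rademacher sums, as a count of sign vectors. -/
theorem card_le_abs_signed_sum_le {N : ℕ} {a : Fin N → ℝ} (ha : ∀ i, |a i| ≤ 1)
    {t : ℝ} (ht : 0 ≤ t) :
    ((Finset.univ.filter fun σ : Fin N → Bool =>
        N * t ≤ |∑ i, if σ i then a i else -a i|).card : ℝ)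
      ≤ 2 ^ N * (2 * Real.exp (-(N * t ^ 2 / 2))) := by
  have hpos := card_le_signed_sum_le ha ht
  have hneg := card_le_signed_sum_le (a := fun i => -a i) (fun i => by simpa using ha i) ht
  have hsub : (Finset.univ.filter fun σ : Fin N → Bool =>
        N * t ≤ |∑ i, if σ i then a i else -a i|) ⊆
      (Finset.univ.filter fun σ : Fin N → Bool => N * t ≤ ∑ i, if σ i then a i else -a i) ∪
      Finset.univ.filter fun σ : Fin N → Bool => N * t ≤ ∑ i, if σ i then -a i else - -a i := by
    intro σ hσ
    have hneg_sum : (∑ i, if σ i then -a i else - -a i) = -∑ i, if σ i then a i else -a i := by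
      rw [← Finset.sum_neg_distrib]
      exact Finset.sum_congr rfl fun i _ => by split_ifs <;> rfl
    simp only [Finset.mem_union, Finset.mem_filter, Finset.mem_univ, true_and, hneg_sum] at hσ ⊢
    exact le_abs.1 hσ
  have hcard : ((Finset.univ.filter fun σ : Fin N → Bool =>
      N * t ≤ |∑ i, if σ i then a i else -a i|).card : ℝ) ≤ _ :=
    Nat.cast_le.2 ((Finset.card_le_card hsub).trans (Finset.card_union_le _ _))
  push_cast at hcard
  linarith

/-! ### Symmetrization -/

/-- Symmetrization for outer measures. Neither `E` nor `D` need be measurable: the sections of a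
measurable hull of `D` have mass at least `1 / 2` on a measurable superset of `E`. -/
theorem MeasureTheory.measure_le_two_mul_prod {α β : Type*} [MeasurableSpace α]
    [MeasurableSpace β] (μ : Measure α) (ν : Measure β) [SFinite ν]
    {E : Set α} {D : Set (α × β)} (h : ∀ x ∈ E, 2⁻¹ ≤ ν (Prod.mk x ⁻¹' D)) :
    μ E ≤ 2 * μ.prod ν D := by
  have hm := measurableSet_toMeasurable (μ.prod ν) D
  rw [← measure_toMeasurable D, Measure.prod_apply hm]
  have hsub : E ⊆ {x | 2⁻¹ ≤ ν (Prod.mk x ⁻¹' toMeasurable (μ.prod ν) D)} := fun x hx =>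
    (h x hx).trans (measure_mono (preimage_mono (subset_toMeasurable _ _)))
  have hmarkov := mul_meas_ge_le_lintegral (μ := μ) (measurable_measure_prodMk_left (ν := ν) hm)
    2⁻¹
  calc μ E ≤ 2 * (2⁻¹ * μ {x | 2⁻¹ ≤ ν (Prod.mk x ⁻¹' toMeasurable (μ.prod ν) D)}) := by
        rw [← mul_assoc, ENNReal.mul_inv_cancel two_ne_zero ENNReal.ofNat_ne_top, one_mul]
        exact measure_mono hsub
    _ ≤ _ := by gcongr

/-- Exchanges the two components of the `i`-th pair whenever `σ i = false`. -/
def swapPairs {X : Type*} {N : ℕ} (σ : Fin N → Bool) (z : Fin N → X × X) : Fin N → X × X :=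
  fun i => if σ i then z i else (z i).swap

theorem measurePreserving_swapPairs {X : Type*} [MeasurableSpace X] (η : Measure X)
    [SigmaFinite η] {N : ℕ} (σ : Fin N → Bool) :
    MeasurePreserving (swapPairs σ) (Measure.pi fun _ : Fin N => η.prod η)
      (Measure.pi fun _ : Fin N => η.prod η) := by
  refine measurePreserving_pi (fun _ => η.prod η) (fun _ => η.prod η)
    (f := fun i (q : X × X) => if σ i then q else q.swap) fun i => ?_
  cases σ i
  · simpa using! Measure.measurePreserving_swap (μ := η) (ν := η)
  · simpa using! MeasurePreserving.id (η.prod η)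

open Classical in
/-- The law of a double sample is invariant under exchanges, so the probability of an event is the
mean over all exchanges, and is controlled by counting exchanges of a fixed double sample. -/
theorem measure_le_of_card_swapPairs_le {X : Type*} [MeasurableSpace X] (η : Measure X)
    [IsProbabilityMeasure η] {N : ℕ} {D : Set (Fin N → X × X)}
    (hD : NullMeasurableSet D (Measure.pi fun _ : Fin N => η.prod η)) {B : ℝ}
    (h : ∀ z, ((Finset.univ.filter fun σ : Fin N → Bool => swapPairs σ z ∈ D).card : ℝ)
      ≤ 2 ^ N * B) :
    (Measure.pi fun _ : Fin N => η.prod η) D ≤ ENNReal.ofReal B := by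
  set Q := Measure.pi fun _ : Fin N => η.prod η
  have hpre : ∀ σ : Fin N → Bool, NullMeasurableSet (swapPairs σ ⁻¹' D) Q := fun σ =>
    hD.preimage (measurePreserving_swapPairs η σ).quasiMeasurePreserving
  have hsum : (2 : ENNReal) ^ N * Q D ≤ 2 ^ N * ENNReal.ofReal B := by
    calc (2 : ENNReal) ^ N * Q D = ∑ σ : Fin N → Bool, Q (swapPairs σ ⁻¹' D) := by
          rw [Finset.sum_congr rfl fun σ _ =>
            (measurePreserving_swapPairs η σ).measure_preimage hD]
          simp [Q]
      _ = ∑ σ : Fin N → Bool, ∫⁻ z, (swapPairs σ ⁻¹' D).indicator 1 z ∂Q :=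
          Finset.sum_congr rfl fun σ _ => (lintegral_indicator_one₀ (hpre σ)).symm
      _ = ∫⁻ z, ∑ σ : Fin N → Bool, (swapPairs σ ⁻¹' D).indicator 1 z ∂Q :=
          (lintegral_finsetSum' _ fun σ _ => aemeasurable_const.indicator₀ (hpre σ)).symm
      _ ≤ ∫⁻ _, 2 ^ N * ENNReal.ofReal B ∂Q := by
          refine lintegral_mono fun z => ?_
          have hcard : ∑ σ : Fin N → Bool,
                (swapPairs σ ⁻¹' D).indicator (1 : (Fin N → X × X) → ENNReal) z
              = ((Finset.univ.filter fun σ : Fin N → Bool => swapPairs σ z ∈ D).card :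
                ENNReal) := by
            simp [indicator_apply]
          rw [hcard, ← ENNReal.ofReal_natCast, show (2 : ENNReal) ^ N = ENNReal.ofReal (2 ^ N) by
            simp [ENNReal.ofReal_pow], ← ENNReal.ofReal_mul (by positivity)]
          exact ENNReal.ofReal_le_ofReal (h z)
      _ = 2 ^ N * ENNReal.ofReal B := by simp
  exact (ENNReal.mul_le_mul_iff_right (by simp) (by simp)).1 hsum

/-- Chebyshev's inequality for the empirical mean of a `[0, 1]`-valued function. -/
theorem measure_empirical_deviation_le {X : Type*} [MeasurableSpace X] (η : Measure X)
    [IsProbabilityMeasure η] {N : ℕ} (hN : 0 < N) {g : X → ℝ} (hg : Measurable g)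
    (hg01 : ∀ x, g x ∈ Icc (0 : ℝ) 1) {t : ℝ} (ht : 0 < t) :
    (Measure.pi fun _ : Fin N => η) {x | t ≤ |1 / (N : ℝ) * ∑ i, g (x i) - ∫ x, g x ∂η|}
      ≤ ENNReal.ofReal (1 / (4 * N * t ^ 2)) := by
  have hN' : (0 : ℝ) < N := Nat.cast_pos.2 hN
  have hbd : ∀ x, ‖g x‖ ≤ 1 := fun x => by
    rw [Real.norm_eq_abs, abs_of_nonneg (hg01 x).1]; exact (hg01 x).2
  have hL2 : MemLp g 2 η := MemLp.of_bound hg.aestronglyMeasurable 1 (ae_of_all _ hbd)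
  set S : (Fin N → X) → ℝ := ∑ i : Fin N, fun x : Fin N → X => g (x i) with hS
  have hSL2 : MemLp S 2 (Measure.pi fun _ : Fin N => η) :=
    memLp_finsetSum' _ fun i _ => hL2.comp_measurePreserving
      (measurePreserving_eval (fun _ : Fin N => η) i)
  have hmean : ∫ x, S x ∂(Measure.pi fun _ : Fin N => η) = N * ∫ x, g x ∂η := by
    simp only [hS, Finset.sum_apply]
    rw [integral_finsetSum _ fun i _ => ?_]
    · simp_rw [integral_comp_eval (μ := fun _ : Fin N => η) hg.aestronglyMeasurable]
      simp
    · exact (measurePreserving_eval (fun _ : Fin N => η) i).integrable_comp_of_integrable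
        (hL2.integrable one_le_two)
  have hvar : Var[S; Measure.pi fun _ : Fin N => η] ≤ N / 4 := by
    rw [hS, variance_sum_pi fun _ => hL2]
    have := variance_le_sq_of_bounded (ae_of_all η hg01) hg.aemeasurable
    simp only [Finset.sum_const, Finset.card_univ, Fintype.card_fin, nsmul_eq_mul]
    nlinarith
  have hcheb := meas_ge_le_variance_div_sq hSL2 (mul_pos hN' ht)
  refine (measure_mono fun x hx => ?_).trans (hcheb.trans (ENNReal.ofReal_le_ofReal ?_))
  · simp only [mem_ofPred_eq] at hx ⊢
    rw [hmean]
    have hSx : S x - N * ∫ x, g x ∂η = N * (1 / (N : ℝ) * ∑ i, g (x i) - ∫ x, g x ∂η) := by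
      simp only [hS, Finset.sum_apply]
      field_simp
    rw [hSx, abs_mul, abs_of_pos hN']
    gcongr
  · calc _ ≤ (N / 4 : ℝ) / (N * t) ^ 2 := by gcongr
      _ = _ := by field_simp

/-! ### The deviation inequality -/

namespace ReachAvoid

theorem abs_sub_rpow_mem_Icc {s t p : ℝ} (hs : s ∈ Icc (0 : ℝ) 1) (ht : t ∈ Icc (0 : ℝ) 1)
    (hp : 0 ≤ p) : |s - t| ^ p ∈ Icc (0 : ℝ) 1 :=
  ⟨Real.rpow_nonneg (abs_nonneg _) p, Real.rpow_le_one (abs_nonneg _)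
    (abs_le.2 ⟨by linarith [hs.1, ht.2], by linarith [hs.2, ht.1]⟩) hp⟩

theorem FinitelyParameterized.measurable {X : Type*} [MeasurableSpace X] {F : Set (X → ℝ)}
    (hF : FinitelyParameterized F) {w : X → ℝ} (hw : w ∈ F) : Measurable w := by
  obtain ⟨m, Θ, f, -, hf, rfl⟩ := hF
  obtain ⟨θ, -, rfl⟩ := hw
  exact hf.comp measurable_prodMk_left

/-- The double samples on which the two empirical means of `|w - U| ^ p` differ by at least `t` for
some `w` in the class `F`. -/
def doubleDeviation {X : Type*} (F : Set (X → ℝ)) (U : X → ℝ) (p : ℝ) (N : ℕ) (t : ℝ) :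
    Set (Fin N → X × X) :=
  {z | ∃ w ∈ F,
    N * t ≤ |∑ i, (|w (z i).1 - U (z i).1| ^ p - |w (z i).2 - U (z i).2| ^ p)|}

/-- The union over the uncountable class is a projection along the parameter set. -/
theorem FinitelyParameterized.nullMeasurableSet_doubleDeviation {X : Type*} [MeasurableSpace X]
    {N : ℕ} [MeasurableSpace.CountablyGenerated (Fin N → X × X)]
    [MeasurableSpace.SeparatesPoints (Fin N → X × X)] {F : Set (X → ℝ)}
    (hF : FinitelyParameterized F) {U : X → ℝ} (hU : Measurable U) (p t : ℝ)
    (μ : Measure (Fin N → X × X)) [IsFiniteMeasure μ] :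
    NullMeasurableSet (doubleDeviation F U p N t) μ := by
  obtain ⟨m, Θ, f, hΘ, hf, rfl⟩ := hF
  have h1 : ∀ i : Fin N, Measurable fun q : EuclideanSpace ℝ (Fin m) × (Fin N → X × X) =>
      |f q.1 (q.2 i).1 - U (q.2 i).1| ^ p := fun i =>
    (((hf.comp (measurable_fst.prodMk (by fun_prop :
      Measurable fun q : EuclideanSpace ℝ (Fin m) × (Fin N → X × X) => (q.2 i).1))).sub
      (hU.comp (by fun_prop))).abs).pow_const p
  have h2 : ∀ i : Fin N, Measurable fun q : EuclideanSpace ℝ (Fin m) × (Fin N → X × X) =>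
      |f q.1 (q.2 i).2 - U (q.2 i).2| ^ p := fun i =>
    (((hf.comp (measurable_fst.prodMk (by fun_prop :
      Measurable fun q : EuclideanSpace ℝ (Fin m) × (Fin N → X × X) => (q.2 i).2))).sub
      (hU.comp (by fun_prop))).abs).pow_const p
  have hB : MeasurableSet {q : EuclideanSpace ℝ (Fin m) × (Fin N → X × X) | q.1 ∈ Θ ∧
      N * t ≤ |∑ i, (|f q.1 (q.2 i).1 - U (q.2 i).1| ^ p
        - |f q.1 (q.2 i).2 - U (q.2 i).2| ^ p)|} :=
    (measurable_fst hΘ).inter (measurableSet_le measurable_const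
      (Finset.measurable_sum _ fun i _ => (h1 i).sub (h2 i)).abs)
  convert hB.nullMeasurableSet_image_snd μ using 1
  ext z
  constructor
  · rintro ⟨_, ⟨θ, hθ, rfl⟩, h⟩
    exact ⟨(θ, z), ⟨hθ, h⟩, rfl⟩
  · rintro ⟨⟨θ, z⟩, ⟨hθ, h⟩, rfl⟩
    exact ⟨f θ, ⟨θ, hθ, rfl⟩, h⟩

/-- Members of the class with the same pattern at the grid thresholds `U y ± (j / L) ^ (1 / p)` give
nearly the same values of `|w - U| ^ p` on the double sample, so Hoeffding's inequality is needed
for finitely many members only. -/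
theorem card_swapPairs_mem_doubleDeviation_le {X : Type*} {F : Set (X → ℝ)}
    (hF : ∀ w ∈ F, ∀ x, w x ∈ Icc (0 : ℝ) 1) {d : ℕ} (hd : pseudoDim F = d) {U : X → ℝ}
    (hU : ∀ x, U x ∈ Icc (0 : ℝ) 1) {p : ℝ} (hp : 0 < p) {N L : ℕ} (hL : 0 < L) {t : ℝ}
    (ht : 0 ≤ t) [DecidablePred (· ∈ doubleDeviation F U p N (t + 2 / L))]
    (z : Fin N → X × X) :
    ((Finset.univ.filter fun σ : Fin N → Bool =>
        swapPairs σ z ∈ doubleDeviation F U p N (t + 2 / L)).card : ℝ)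
      ≤ 2 ^ N * (((∑ k ∈ Finset.Iic d, (4 * N * (L + 1)).choose k : ℕ) : ℝ) *
        (2 * Real.exp (-(N * t ^ 2 / 2)))) := by
  classical
  let y : Fin N × Bool × Fin (L + 1) × Bool → X := fun k =>
    if k.2.1 then (z k.1).1 else (z k.1).2
  let c : Fin N × Bool × Fin (L + 1) × Bool → ℝ := fun k =>
    U (y k) + if k.2.2.2 then ((k.2.2.1 : ℕ) / L : ℝ) ^ (1 / p)
      else -((k.2.2.1 : ℕ) / L : ℝ) ^ (1 / p)
  obtain ⟨R, hRcard, hRF, hR⟩ := exists_finset_pattern_eq hF hd y c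
  have hcard : Fintype.card (Fin N × Bool × Fin (L + 1) × Bool) = 4 * N * (L + 1) := by
    simp only [Fintype.card_prod, Fintype.card_fin, Fintype.card_bool]
    ring
  rw [hcard] at hRcard
  let a : (X → ℝ) → Fin N → ℝ := fun w i =>
    |w (z i).1 - U (z i).1| ^ p - |w (z i).2 - U (z i).2| ^ p
  have ha : ∀ w ∈ F, ∀ i, |a w i| ≤ 1 := by
    intro w hw i
    have h1 := abs_sub_rpow_mem_Icc (hF w hw (z i).1) (hU (z i).1) hp.le
    have h2 := abs_sub_rpow_mem_Icc (hF w hw (z i).2) (hU (z i).2) hp.le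
    exact abs_le.2 ⟨by linarith [h1.1, h2.2], by linarith [h1.2, h2.1]⟩
  have hclose : ∀ w ∈ F, ∀ v ∈ F, pattern y c v = pattern y c w → ∀ i (s : Bool),
      |(|w (if s then (z i).1 else (z i).2) - U (if s then (z i).1 else (z i).2)| ^ p
        - |v (if s then (z i).1 else (z i).2) - U (if s then (z i).1 else (z i).2)| ^ p)|
        ≤ 1 / L := by
    intro w hw v hv hvw i s
    have hmem : ∀ (j : ℕ) (hj : j ≤ L) (b : Bool),
        c (i, s, ⟨j, Nat.lt_succ_of_le hj⟩, b) ≤ w (if s then (z i).1 else (z i).2) ↔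
        c (i, s, ⟨j, Nat.lt_succ_of_le hj⟩, b) ≤ v (if s then (z i).1 else (z i).2) := by
      intro j hj b
      have := Finset.ext_iff.1 hvw (i, s, ⟨j, Nat.lt_succ_of_le hj⟩, b)
      rw [mem_pattern, mem_pattern] at this
      exact this.symm
    have hbd : ∀ u ∈ F, ∀ x, |u x - U x| ≤ 1 := fun u hu x => abs_le.2
      ⟨by linarith [(hF u hu x).1, (hU x).2], by linarith [(hF u hu x).2, (hU x).1]⟩
    refine abs_sub_abs_rpow_le_inv_of_forall_threshold hL hp (hbd w hw _) (hbd v hv _)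
      (fun j hj => ?_) fun j hj => ?_
    · rw [le_sub_iff_add_le', le_sub_iff_add_le']
      simpa [c, y] using hmem j hj true
    · rw [le_sub_iff_add_le', le_sub_iff_add_le']
      simpa [c, y] using hmem j hj false
  have hswap : ∀ (σ : Fin N → Bool) (w : X → ℝ),
      (∑ i, (|w (swapPairs σ z i).1 - U (swapPairs σ z i).1| ^ p
        - |w (swapPairs σ z i).2 - U (swapPairs σ z i).2| ^ p))
        = ∑ i, if σ i then a w i else -a w i := by
    intro σ w
    refine Finset.sum_congr rfl fun i _ => ?_
    by_cases h : σ i <;> simp [swapPairs, h, a]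
  have hsub : (Finset.univ.filter fun σ : Fin N → Bool =>
      swapPairs σ z ∈ doubleDeviation F U p N (t + 2 / L)) ⊆
      R.biUnion fun v => Finset.univ.filter fun σ : Fin N → Bool =>
        N * t ≤ |∑ i, if σ i then a v i else -a v i| := by
    intro σ hσ
    obtain ⟨w, hw, hdev⟩ := (Finset.mem_filter.1 hσ).2
    obtain ⟨v, hvR, hvw⟩ := hR w hw
    refine Finset.mem_biUnion.2 ⟨v, hvR, Finset.mem_filter.2 ⟨Finset.mem_univ _, ?_⟩⟩
    rw [hswap] at hdev
    have hdiff : |(∑ i, if σ i then a w i else -a w i) - ∑ i, if σ i then a v i else -a v i|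
        ≤ N * (2 / L) := by
      rw [← Finset.sum_sub_distrib]
      refine (Finset.abs_sum_le_sum_abs _ _).trans ?_
      calc _ ≤ ∑ _i : Fin N, (2 / L : ℝ) := by
            refine Finset.sum_le_sum fun i _ => ?_
            have h1 := abs_le.1 (hclose w hw v (hRF v hvR) hvw i true)
            have h2 := abs_le.1 (hclose w hw v (hRF v hvR) hvw i false)
            simp only [if_true, Bool.false_eq_true, if_false] at h1 h2
            have h3 : (2 / L : ℝ) = 1 / L + 1 / L := by ring
            rw [h3, abs_le]
            split_ifs <;> simp only [a] <;> constructor <;> linarith [h1.1, h1.2, h2.1, h2.2]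
        _ = N * (2 / L) := by simp
    have := abs_sub_abs_le_abs_sub (∑ i, if σ i then a w i else -a w i)
      (∑ i, if σ i then a v i else -a v i)
    linarith
  calc _ ≤ ((∑ v ∈ R, (Finset.univ.filter fun σ : Fin N → Bool =>
        N * t ≤ |∑ i, if σ i then a v i else -a v i|).card : ℕ) : ℝ) :=
        Nat.cast_le.2 ((Finset.card_le_card hsub).trans Finset.card_biUnion_le)
    _ ≤ ∑ _v ∈ R, 2 ^ N * (2 * Real.exp (-(N * t ^ 2 / 2))) := by
        push_cast
        exact Finset.sum_le_sum fun v hv => card_le_abs_signed_sum_le (ha v (hRF v hv)) ht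
    _ = R.card * (2 ^ N * (2 * Real.exp (-(N * t ^ 2 / 2)))) := by simp
    _ ≤ ((∑ k ∈ Finset.Iic d, (4 * N * (L + 1)).choose k : ℕ) : ℝ) *
        (2 ^ N * (2 * Real.exp (-(N * t ^ 2 / 2)))) := by
        gcongr
    _ = _ := by ring

/-- The threshold `3 / 4 * b` splits as `1 / 8 * b` for Chebyshev's inequality on the second sample,
`1 / 8 * b` for the discretization and `1 / 2 * b` for Hoeffding's inequality. -/
theorem measure_exists_deviation_le {X : Type*} [MeasurableSpace X] {N : ℕ}
    [MeasurableSpace.CountablyGenerated (Fin N → X × X)]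
    [MeasurableSpace.SeparatesPoints (Fin N → X × X)] {F : Set (X → ℝ)}
    (hF : FinitelyParameterized F) (hF01 : ∀ w ∈ F, ∀ x, w x ∈ Icc (0 : ℝ) 1) {d : ℕ}
    (hd : pseudoDim F = d) {U : X → ℝ} (hU : Measurable U) (hU01 : ∀ x, U x ∈ Icc (0 : ℝ) 1)
    (η : Measure X) [IsProbabilityMeasure η] (hN : 0 < N) {p : ℝ} (hp : 0 < p) {b : ℝ}
    (hb : 0 < b) (hNb : 32 ≤ N * b ^ 2) {L : ℕ} (hL : 16 ≤ b * L) :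
    (Measure.pi fun _ : Fin N => η) {x | ∃ w ∈ F, 3 / 4 * b <
        |1 / (N : ℝ) * ∑ i, |w (x i) - U (x i)| ^ p - ∫ x, |w x - U x| ^ p ∂η|}
      ≤ ENNReal.ofReal (4 * ((∑ k ∈ Finset.Iic d, (4 * N * (L + 1)).choose k : ℕ) : ℝ) *
        Real.exp (-(N * b ^ 2 / 8))) := by
  classical
  have hN' : (0 : ℝ) < N := Nat.cast_pos.2 hN
  have hL' : (0 : ℝ) < L := by
    by_contra h
    nlinarith [not_lt.1 h]
  set μ := Measure.pi fun _ : Fin N => η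
  set D := doubleDeviation F U p N (b / 2 + 2 / L)
  have hD : NullMeasurableSet D (Measure.pi fun _ : Fin N => η.prod η) :=
    hF.nullMeasurableSet_doubleDeviation hU p _ _
  have hswap := measure_le_of_card_swapPairs_le η hD
    (card_swapPairs_mem_doubleDeviation_le hF01 hd hU01 hp (Nat.cast_pos.1 hL') (half_pos hb).le)
  let e := MeasurableEquiv.arrowProdEquivProdArrow X X (Fin N)
  have he : μ.prod μ (e.symm ⁻¹' D) = Measure.pi (fun _ : Fin N => η.prod η) D :=
    ((measurePreserving_arrowProdEquivProdArrow X X (Fin N) (fun _ => η)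
      fun _ => η).symm e).measure_preimage hD
  have hsym : μ {x | ∃ w ∈ F, 3 / 4 * b <
      |1 / (N : ℝ) * ∑ i, |w (x i) - U (x i)| ^ p - ∫ x, |w x - U x| ^ p ∂η|}
      ≤ 2 * μ.prod μ (e.symm ⁻¹' D) := by
    refine measure_le_two_mul_prod μ μ fun x hx => ?_
    obtain ⟨w, hw, hdev⟩ := hx
    have hcheb := measure_empirical_deviation_le η hN (g := fun x => |w x - U x| ^ p)
      (((hF.measurable hw).sub hU).abs.pow_const p)
      (fun x => abs_sub_rpow_mem_Icc (hF01 w hw x) (hU01 x) hp.le) (t := b / 8) (by positivity)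
    have hhalf : ENNReal.ofReal (1 / (4 * N * (b / 8) ^ 2)) ≤ 2⁻¹ := by
      rw [show (2⁻¹ : ENNReal) = ENNReal.ofReal 2⁻¹ by
        rw [ENNReal.ofReal_inv_of_pos two_pos, ENNReal.ofReal_ofNat]]
      refine ENNReal.ofReal_le_ofReal ?_
      rw [one_div]
      exact inv_anti₀ two_pos (by nlinarith)
    have hsplit : (1 : ENNReal) ≤ 2⁻¹ + μ (Prod.mk x ⁻¹' (e.symm ⁻¹' D)) := by
      rw [← measure_univ (μ := μ)]
      refine le_trans ?_ (add_le_add_left (hcheb.trans hhalf) _)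
      refine (measure_mono fun x' _ => ?_).trans (measure_union_le _ _)
      by_cases hx' : b / 8 ≤ |1 / (N : ℝ) * ∑ i, |w (x' i) - U (x' i)| ^ p
          - ∫ x, |w x - U x| ^ p ∂η|
      · exact Or.inl hx'
      · refine Or.inr ⟨w, hw, ?_⟩
        change N * (b / 2 + 2 / L) ≤
          |∑ i, (|w (x i) - U (x i)| ^ p - |w (x' i) - U (x' i)| ^ p)|
        have hLb : 2 / (L : ℝ) ≤ b / 8 := by
          rw [div_le_div_iff₀ hL' (by norm_num)]
          linarith
        have heq : ∑ i, (|w (x i) - U (x i)| ^ p - |w (x' i) - U (x' i)| ^ p)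
            = N * ((1 / (N : ℝ) * ∑ i, |w (x i) - U (x i)| ^ p - ∫ x, |w x - U x| ^ p ∂η)
              - (1 / (N : ℝ) * ∑ i, |w (x' i) - U (x' i)| ^ p
                - ∫ x, |w x - U x| ^ p ∂η)) := by
          rw [Finset.sum_sub_distrib]
          field_simp
          ring
        rw [heq, abs_mul, abs_of_pos hN']
        refine mul_le_mul_of_nonneg_left ?_ hN'.le
        refine le_trans ?_ (abs_sub_abs_le_abs_sub _ _)
        linarith [not_le.1 hx']
    rw [← ENNReal.inv_two_add_inv_two] at hsplit
    exact (ENNReal.add_le_add_iff_left (by simp)).1 hsplit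
  refine hsym.trans ?_
  rw [he]
  refine (mul_le_mul_right hswap 2).trans_eq ?_
  rw [← ENNReal.ofReal_ofNat 2, ← ENNReal.ofReal_mul zero_le_two]
  ring_nf

/-- Comparison of the bound obtained from the Sauer–Shelah lemma with the required one. The decay
rate `1 / 8` exceeds `1 / 128` so much that the surplus absorbs the cruder polynomial factor
whenever the required bound is not trivial. -/
theorem sum_choose_mul_exp_le {N d L : ℕ} {b : ℝ} (hb : 0 < b) (hb1 : b ≤ 1) (hL : b * L ≤ 17)
    (hQ : 4 * Real.exp 1 * ((d : ℝ) + 1) * (32 * Real.exp 1 / b) ^ d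
      * Real.exp (-((N : ℝ) * b ^ 2) / 128) ≤ 1) :
    4 * ((∑ k ∈ Finset.Iic d, (4 * N * (L + 1)).choose k : ℕ) : ℝ) * Real.exp (-(N * b ^ 2 / 8))
      ≤ 4 * Real.exp 1 * ((d : ℝ) + 1) * (32 * Real.exp 1 / b) ^ d
        * Real.exp (-((N : ℝ) * b ^ 2) / 128) := by
  set M : ℝ := ((∑ k ∈ Finset.Iic d, (4 * N * (L + 1)).choose k : ℕ) : ℝ) with hM
  set E := Real.exp (-((N : ℝ) * b ^ 2) / 128) with hE
  set Q := 4 * Real.exp 1 * ((d : ℝ) + 1) * (32 * Real.exp 1 / b) ^ d with hQdef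
  have he : 1 ≤ Real.exp 1 := Real.one_le_exp zero_le_one
  have hE0 : 0 < E := Real.exp_pos _
  have hE1 : E ≤ 1 := Real.exp_le_one_iff.2
    (by rw [neg_div, neg_nonpos]; positivity)
  have hM0 : 0 ≤ M := Nat.cast_nonneg _
  have hQ0 : 0 < Q := by positivity
  -- The rate `l` is chosen so that `l` times the number of thresholds is at most `N * b ^ 2 / 32`.
  obtain ⟨l, hl⟩ : ∃ l : ℝ, l = b ^ 3 / 2304 := ⟨_, rfl⟩
  have hl0 : 0 < l := by rw [hl]; positivity
  have hl1 : l ≤ 1 := by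
    have : b ^ 3 ≤ 1 := pow_le_one₀ hb.le hb1
    rw [hl]; linarith
  have h1 : M * l ^ d ≤ Real.exp (N * b ^ 2 / 32) := by
    refine (sum_choose_mul_pow_le_exp (4 * N * (L + 1)) d hl0 hl1).trans (Real.exp_le_exp.2 ?_)
    push_cast
    have : l * (4 * N * (L + 1)) = N * b ^ 2 / 576 * (b * L + b) := by rw [hl]; ring
    rw [this]
    have h0 : 0 ≤ N * b ^ 2 / 576 := by positivity
    nlinarith
  have h2 : Real.exp (N * b ^ 2 / 32) * Real.exp (-(N * b ^ 2 / 8)) ≤ E ^ 3 := by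
    rw [hE, ← Real.exp_nat_mul, ← Real.exp_add]
    refine Real.exp_le_exp.2 ?_
    have : 0 ≤ N * b ^ 2 := by positivity
    push_cast
    linarith
  have h3 : 4 ≤ Q ^ 3 * l ^ d := by
    have hQ4 : 4 * (32 / b) ^ d ≤ Q := by
      rw [hQdef]
      have hd0 : (0 : ℝ) ≤ d := Nat.cast_nonneg d
      have hc : 4 ≤ 4 * Real.exp 1 * ((d : ℝ) + 1) := by nlinarith
      gcongr
      linarith
    have hpow : 1 ≤ ((32 / b) ^ 3 * l) ^ d := by
      refine one_le_pow₀ ?_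
      rw [hl, div_pow, div_mul_div_comm, mul_comm (b ^ 3), mul_div_mul_right _ _ (by positivity)]
      norm_num
    calc (4 : ℝ) ≤ 64 * ((32 / b) ^ 3 * l) ^ d := by linarith
      _ = (4 * (32 / b) ^ d) ^ 3 * l ^ d := by rw [mul_pow, mul_pow, pow_right_comm]; ring
      _ ≤ Q ^ 3 * l ^ d := by gcongr
  calc 4 * M * Real.exp (-(N * b ^ 2 / 8))
      ≤ Q ^ 3 * l ^ d * M * Real.exp (-(N * b ^ 2 / 8)) := by gcongr
    _ = Q ^ 3 * ((M * l ^ d) * Real.exp (-(N * b ^ 2 / 8))) := by ring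
    _ ≤ Q ^ 3 * (Real.exp (N * b ^ 2 / 32) * Real.exp (-(N * b ^ 2 / 8))) := by gcongr
    _ ≤ Q ^ 3 * E ^ 3 := by gcongr
    _ = (Q * E) ^ 3 := by ring
    _ ≤ Q * E := pow_le_of_le_one (by positivity) hQ (by norm_num)

/-! ### The dynamic programming operator and the norms -/

theorem measurable_dpOperator {X 𝒜 : Type*} [MeasurableSpace X] [MeasurableSpace 𝒜] [Fintype 𝒜]
    [Nonempty 𝒜] (Tx : Kernel (X × 𝒜) X) [IsSFiniteKernel Tx] {A K : Set X}
    (hA : MeasurableSet A) (hK : MeasurableSet K) {V : X → ℝ} (hV : Measurable V) :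
    Measurable (dpOperator Tx A K V) := by
  have h : Measurable (Finset.univ.sup' Finset.univ_nonempty fun (a : 𝒜) (x : X) =>
      ∫ y, (K.indicator (fun _ => (1 : ℝ)) y + (A \ K).indicator V y) ∂(Tx (x, a))) := by
    refine Finset.measurable_sup' _ fun a _ => ?_
    have hm : StronglyMeasurable fun y =>
        K.indicator (fun _ => (1 : ℝ)) y + (A \ K).indicator V y :=
      ((measurable_const.indicator hK).add (hV.indicator (hA.diff hK))).stronglyMeasurable
    exact (hm.integral_kernel (κ := Tx)).measurable.comp measurable_prodMk_right
  convert h using 1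
  ext x
  simp [dpOperator, Finset.sup'_apply]

theorem integral_mem_Icc {X : Type*} [MeasurableSpace X] (η : Measure X) [IsProbabilityMeasure η]
    {g : X → ℝ} (hg : ∀ x, g x ∈ Icc (0 : ℝ) 1) : ∫ x, g x ∂η ∈ Icc (0 : ℝ) 1 := by
  refine ⟨integral_nonneg fun y => (hg y).1, ?_⟩
  have := norm_integral_le_of_norm_le_const (μ := η) (C := 1) (ae_of_all _ fun y => by
    rw [Real.norm_eq_abs, abs_of_nonneg (hg y).1]; exact (hg y).2)
  simpa using (Real.le_norm_self _).trans this

theorem dpOperator_mem_Icc {X 𝒜 : Type*} [MeasurableSpace X] [MeasurableSpace 𝒜] [Fintype 𝒜]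
    [Nonempty 𝒜] (Tx : Kernel (X × 𝒜) X) [IsMarkovKernel Tx] {A K : Set X} {V : X → ℝ}
    (hV01 : ∀ x, V x ∈ Icc (0 : ℝ) 1) (x : X) : dpOperator Tx A K V x ∈ Icc (0 : ℝ) 1 := by
  have hbd : ∀ y, K.indicator (fun _ => (1 : ℝ)) y + (A \ K).indicator V y ∈ Icc (0 : ℝ) 1 := by
    intro y
    by_cases hyK : y ∈ K
    · simp [hyK]
    · by_cases hyA : y ∈ A
      · simpa [hyK, hyA] using hV01 y
      · simp [hyK, hyA]
  have hint : ∀ a : 𝒜, ∫ y, (K.indicator (fun _ => (1 : ℝ)) y + (A \ K).indicator V y)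
      ∂(Tx (x, a)) ∈ Icc (0 : ℝ) 1 := fun a =>
    integral_mem_Icc (Tx (x, a)) hbd
  obtain ⟨a⟩ := ‹Nonempty 𝒜›
  exact ⟨(hint a).1.trans (Finset.le_sup' (f := fun a : 𝒜 => ∫ y,
    (K.indicator (fun _ => (1 : ℝ)) y + (A \ K).indicator V y) ∂(Tx (x, a))) (Finset.mem_univ a)),
    Finset.sup'_le _ _ fun a _ => (hint a).2⟩

theorem weightedNorm_rpow {X : Type*} [MeasurableSpace X] {p : ℝ} (hp : p ≠ 0) (η : Measure X)
    (h : X → ℝ) : weightedNorm p η h ^ p = ∫ x, |h x| ^ p ∂η := by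
  rw [weightedNorm, ← Real.rpow_mul (integral_nonneg fun x => Real.rpow_nonneg (abs_nonneg _) p),
    one_div_mul_cancel hp, Real.rpow_one]

theorem empiricalNorm_rpow {X : Type*} {N : ℕ} {p : ℝ} (hp : p ≠ 0) (x : Fin N → X)
    (h : X → ℝ) : empiricalNorm p x h ^ p = 1 / (N : ℝ) * ∑ i, |h (x i)| ^ p := by
  rw [empiricalNorm, ← Real.rpow_mul (mul_nonneg (by positivity)
    (Finset.sum_nonneg fun i _ => Real.rpow_nonneg (abs_nonneg _) p)),
    one_div_mul_cancel hp, Real.rpow_one]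

theorem empirical_mean_mem_Icc {X : Type*} {N : ℕ} {g : X → ℝ} (hg : ∀ x, g x ∈ Icc (0 : ℝ) 1)
    (x : Fin N → X) : 1 / (N : ℝ) * ∑ i, g (x i) ∈ Icc (0 : ℝ) 1 := by
  have hsum : ∑ i, g (x i) ≤ N := by
    simpa using Finset.sum_le_sum fun i (_ : i ∈ Finset.univ) => (hg (x i)).2
  refine ⟨mul_nonneg (by positivity) (Finset.sum_nonneg fun i _ => (hg _).1), ?_⟩
  rw [one_div_mul_eq_div]
  exact div_le_one_of_le₀ hsum (Nat.cast_nonneg N)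

end ReachAvoid

theorem mainTheorem4
    {n : ℕ} (X : Set (EuclideanSpace ℝ (Fin n)))
    {𝒜 : Type*} [Fintype 𝒜] [Nonempty 𝒜] [MeasurableSpace 𝒜] [DiscreteMeasurableSpace 𝒜]
    (Tx : Kernel (X × 𝒜) X) [IsMarkovKernel Tx]
    (A K : Set X) (hA : MeasurableSet A) (hK : MeasurableSet K)
    (𝒲 : Set (X → ℝ)) (h𝒲 : ReachAvoid.FinitelyParameterized 𝒲)
    (h𝒲01 : ∀ w ∈ 𝒲, ∀ x, w x ∈ Icc (0 : ℝ) 1)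
    (d : ℕ) (hd : ReachAvoid.pseudoDim 𝒲 = d)
    (V : X → ℝ) (hV : Measurable V) (hV01 : ∀ x, V x ∈ Icc (0 : ℝ) 1)
    (η : Measure X) [IsProbabilityMeasure η]
    {Ω : Type*} [MeasurableSpace Ω] (P : Measure Ω) [IsProbabilityMeasure P]
    (N : ℕ) (hN : 0 < N) (ξ : Fin N → Ω → X) (hξ : ∀ i, Measurable (ξ i))
    (hξη : ∀ i, P.map (ξ i) = η) (hindep : iIndepFun ξ P)
    (p : ℝ) (hp : 1 ≤ p) (ε₂ : ℝ) (hε₂ : 0 < ε₂) :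
    P {ω | ε₂ ^ p ≤ ⨆ w : 𝒲,
        |ReachAvoid.weightedNorm p η
            (fun x => (w : X → ℝ) x - ReachAvoid.dpOperator Tx A K V x) ^ p
          - ReachAvoid.empiricalNorm p (fun i => ξ i ω)
            (fun x => (w : X → ℝ) x - ReachAvoid.dpOperator Tx A K V x) ^ p|}
      ≤ ENNReal.ofReal
          (4 * Real.exp 1 * ((d : ℝ) + 1) * (32 * Real.exp 1 / ε₂ ^ p) ^ d
            * Real.exp (-((N : ℝ) * ε₂ ^ (2 * p)) / 128)) := by
  have hp0 : 0 < p := zero_lt_one.trans_le hp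
  have hU := ReachAvoid.measurable_dpOperator Tx hA hK hV
  have hU01 := ReachAvoid.dpOperator_mem_Icc Tx (A := A) (K := K) hV01
  set U := ReachAvoid.dpOperator Tx A K V
  have hb : 0 < ε₂ ^ p := Real.rpow_pos_of_pos hε₂ p
  have hb2 : ε₂ ^ (2 * p) = (ε₂ ^ p) ^ 2 := by
    rw [mul_comm, Real.rpow_mul hε₂.le, Real.rpow_two]
  rw [hb2]
  simp only [ReachAvoid.weightedNorm_rpow hp0.ne', ReachAvoid.empiricalNorm_rpow hp0.ne']
  generalize ε₂ ^ p = b at hb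
  have hg01 : ∀ w ∈ 𝒲, ∀ x, |w x - U x| ^ p ∈ Icc (0 : ℝ) 1 := fun w hw x =>
    ReachAvoid.abs_sub_rpow_mem_Icc (h𝒲01 w hw x) (hU01 x) hp0.le
  have hdev1 : ∀ (ω : Ω) (w : 𝒲), |∫ x, |(w : X → ℝ) x - U x| ^ p ∂η
      - 1 / (N : ℝ) * ∑ i, |(w : X → ℝ) (ξ i ω) - U (ξ i ω)| ^ p| ≤ 1 := by
    intro ω w
    have h1 := ReachAvoid.integral_mem_Icc η (hg01 w w.2)
    have h2 := ReachAvoid.empirical_mean_mem_Icc (hg01 w w.2) fun i => ξ i ω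
    exact abs_le.2 ⟨by linarith [h1.1, h2.2], by linarith [h1.2, h2.1]⟩
  by_cases hb1 : b ≤ 1
  swap
  · -- All deviations are at most `1`, so the event is empty.
    refine le_of_eq_of_le ?_ zero_le
    refine measure_mono_null (fun ω hω => ?_) measure_empty
    exact hb1 (le_trans hω (Real.iSup_le (hdev1 ω) zero_le_one))
  by_cases hQ : 4 * Real.exp 1 * ((d : ℝ) + 1) * (32 * Real.exp 1 / b) ^ d
      * Real.exp (-((N : ℝ) * b ^ 2) / 128) ≤ 1
  swap
  · exact prob_le_one.trans (ENNReal.one_le_ofReal.2 (not_le.1 hQ).le)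
  have hNb : 32 ≤ N * b ^ 2 := by
    by_contra hlt
    refine hQ.not_gt ?_
    have hexp : Real.exp (-1) ≤ Real.exp (-((N : ℝ) * b ^ 2) / 128) :=
      Real.exp_le_exp.2 (by linarith [not_le.1 hlt])
    have hpow : 1 ≤ (32 * Real.exp 1 / b) ^ d := by
      refine one_le_pow₀ ?_
      rw [one_le_div hb]
      linarith [Real.one_le_exp zero_le_one]
    have hd0 : (1 : ℝ) ≤ d + 1 := by linarith [(Nat.cast_nonneg d : (0 : ℝ) ≤ d)]
    calc (1 : ℝ) < 4 * Real.exp 1 * 1 * 1 * Real.exp (-1) := by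
          rw [Real.exp_neg, mul_one, mul_one, mul_assoc, mul_inv_cancel₀ (Real.exp_ne_zero 1)]
          norm_num
      _ ≤ _ := by gcongr
  obtain ⟨L, hL16, hL17⟩ : ∃ L : ℕ, 16 ≤ b * L ∧ b * L ≤ 17 := by
    refine ⟨⌈16 / b⌉₊, ?_, ?_⟩
    · have := Nat.le_ceil (16 / b)
      rwa [div_le_iff₀' hb] at this
    · have := (Nat.ceil_lt_add_one (by positivity : 0 ≤ 16 / b)).le
      calc b * ⌈16 / b⌉₊ ≤ b * (16 / b + 1) := by gcongr
        _ = 16 + b := by field_simp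
        _ ≤ 17 := by linarith
  have hξm : Measurable fun ω i => ξ i ω := measurable_pi_lambda _ hξ
  have hlaw : P.map (fun ω i => ξ i ω) = Measure.pi fun _ : Fin N => η := by
    rw [(iIndepFun_iff_map_fun_eq_pi_map fun i => (hξ i).aemeasurable).1 hindep]
    simp_rw [hξη]
  refine (measure_mono fun ω hω => ?_).trans
    ((Measure.le_map_apply (μ := P) hξm.aemeasurable {x | ∃ w ∈ 𝒲, 3 / 4 * b <
      |1 / (N : ℝ) * ∑ i, |w (x i) - U (x i)| ^ p - ∫ x, |w x - U x| ^ p ∂η|}).trans ?_)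
  · rcases isEmpty_or_nonempty 𝒲 with hemp | hne
    · -- The supremum over the empty class is `0`.
      have : b ≤ 0 := le_trans hω (by rw [Real.iSup_of_isEmpty])
      exact absurd hb this.not_gt
    · obtain ⟨w, hw⟩ := exists_lt_of_lt_ciSup
        (lt_of_lt_of_le (by linarith : 3 / 4 * b < b) hω)
      exact ⟨w, w.2, by rwa [abs_sub_comm]⟩
  · rw [hlaw]
    exact (ReachAvoid.measure_exists_deviation_le h𝒲 h𝒲01 hd hU hU01 η hN hp0 hb hNb hL16).trans
      (ENNReal.ofReal_le_ofReal (ReachAvoid.sum_choose_mul_exp_le hb hb1 hL17 hQ))
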